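/- Let $d\ge 2$, $\mu>0$, $t>0$ and $x_0\in\mathbb{R}^d$. Let $A=[\,0\mid e_1\mid e_2\mid\cdots\mid e_{d-1}]\in\mathbb{R}^{d\times d}$ and $b=e_d\in\mathbb{R}^d$, where $e_i$ is the $i$-th standard basis vector, and let $\mathcal{R}(\{x_0\},t)\subset\mathbb{R}^d$ be the reach set at time $t$ of the $d$-dimensional integrator with control bound $\mu$: the set of all $x(t)$, where $x$ is an absolutely continuous solution of $$\dot x(s)=A\,x(s)+b\,u(s)\quad\text{for a.e. } s\in[0,t],\qquad x(0)=x_0,$$ for some measurable control $u$ with $u(s)\in[-\mu,\mu]$ for all $s\in[0,t]$. Then $\mathcal{R}(\{x_0\},t)$ is Lebesgue measurable, the limit below exists and is finite, and the $d$-dimensional volume (Lebesgue measure) of the reach set is $$\mathrm{vol}\big(\mathcal{R}(\{x_0\},t)\big)=\frac{(2\mu)^d\,t^{d(d+1)/2}}{\prod_{k=1}^{d-1}k!}\;\lim_{n\to\infty}\frac{1}{n^{d(d+1)/2}}\sum_{0\le i_1<i_2<\cdots<i_d\le n}\ \prod_{1\le\alpha<\beta\le d}(i_\beta-i_\alpha).$$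 -/

import Mathlib

open MeasureTheory Set Filter Topology
open scoped Matrix

namespace Integrator

/-- The state matrix `A = [0 | e₁ | e₂ | ⋯ | e_{d-1}]`: column `0` vanishes and column `j + 1` is the
`j`-th basis vector (indices starting at `0`), i.e. `A` is the upper shift matrix. -/
def stateMatrix (d : ℕ) : Matrix (Fin d) (Fin d) ℝ :=
  Matrix.of fun i j => if (i : ℕ) + 1 = (j : ℕ) then 1 else 0

/-- The input vector `b = e_d`, the last basis vector. -/
def inputVector (d : ℕ) : Fin d → ℝ :=
  fun i => if (i : ℕ) + 1 = d then 1 else 0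

/-- `u` is an admissible control on `[0, t]` with bound `μ`: it is measurable and takes values in
`[-μ, μ]` throughout `[0, t]`. -/
def IsControl (μ t : ℝ) (u : ℝ → ℝ) : Prop :=
  Measurable u ∧ ∀ s ∈ Icc 0 t, u s ∈ Icc (-μ) μ

/-- `x` is a (Carathéodory) solution on `[0, t]` of `x' = A x + b u`: it is absolutely continuous
(coordinatewise) and satisfies the differential equation at almost every time in `[0, t]`. -/
def IsTrajectory (d : ℕ) (t : ℝ) (u : ℝ → ℝ) (x : ℝ → Fin d → ℝ) : Prop :=
  (∀ i, AbsolutelyContinuousOnInterval (fun s => x s i) 0 t) ∧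
    ∀ᵐ s ∂(volume.restrict (Icc 0 t)),
      HasDerivAt x (stateMatrix d *ᵥ x s + u s • inputVector d) s

/-- The forward reach set `R(X₀, t)`: all states `x(t)` of solutions that start in `X₀` at time `0`
and are driven by an admissible control. -/
def reachSet (d : ℕ) (μ : ℝ) (X₀ : Set (Fin d → ℝ)) (t : ℝ) : Set (Fin d → ℝ) :=
  {y | ∃ (u : ℝ → ℝ) (x : ℝ → Fin d → ℝ),
    IsControl μ t u ∧ IsTrajectory d t u x ∧ x 0 ∈ X₀ ∧ x t = y}

/-- The sum `∑_{0 ≤ i₁ < i₂ < ⋯ < i_d ≤ n} ∏_{1 ≤ α < β ≤ d} (i_β - i_α)`. -/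
def vandermondeSum (d n : ℕ) : ℝ :=
  ∑ i : Fin d → Fin (n + 1) with ∀ α β, α < β → i α < i β,
    ∏ p : Fin d × Fin d with p.1 < p.2, (((i p.2 : ℕ) : ℝ) - ((i p.1 : ℕ) : ℝ))

end Integrator

/-! Solving the chain of integrators shows that the reach set is a translate of a linear image of
the moment set: time reversal turns the kernel `(t - s) ^ m / m!` into `s ^ m / m!`, and the linear
map has determinant `±1 / ∏ k!` (`reachSet_singleton`, `abs_det_momentMatrix`).

The moment set is convex, so its frontier is null and only its interior matters. By
`interior_momentSet`, the interior is parametrised by the switching times `0 < s₁ < ⋯ < s_d < t` of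
controls with values `±μ`. The image of this simplex is open, because the Jacobian is `(2μ)^d` times
a Vandermonde product up to sign. It is relatively closed in the interior: degenerate switching
times leave fewer than `d` effective switches, and such a control maximizes the linear functional
given by a polynomial of degree `< d`, so its moment vector is not interior. The interior is
connected, hence is the whole image.

The parametrisation is injective (`injOn_switchMoments`), as the difference of two such controls has
the sign of a polynomial of degree `< d`. Changing variables gives `(2μ)^d` times the integral of
the Vandermonde product over the simplex, and the lattice sums are Riemann sums of that integral. -/

open scoped Pointwise

namespace Integrator

/-! ### Bang-bang controls and their moments -/

/-- The set of moment vectors `(∫₀ᵗ s ^ k u(s) ds)_{k < d}` of admissible controls. -/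
def momentSet (d : ℕ) (μ t : ℝ) : Set (Fin d → ℝ) :=
  {m | ∃ u, IsControl μ t u ∧ ∀ k : Fin d, ∫ s in (0 : ℝ)..t, s ^ (k : ℕ) * u s = m k}

/-- The function equal to `1` up to `a` and to `-1` after `a`. -/
noncomputable def switch (a x : ℝ) : ℝ := if x ≤ a then 1 else -1

/-- The bang-bang control that starts at `μ` and changes sign at each `s i`. -/
noncomputable def bangBang {d : ℕ} (μ : ℝ) (s : Fin d → ℝ) (x : ℝ) : ℝ := μ * ∏ i, switch (s i) x

/-- The moment vector of `bangBang μ s` on `[0, t]`, as a polynomial function of `s`. -/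
noncomputable def switchMoments {d : ℕ} (μ t : ℝ) (s : Fin d → ℝ) : Fin d → ℝ := fun k =>
  μ * (t ^ ((k : ℕ) + 1) / ((k : ℕ) + 1) -
    2 * ∑ i : Fin d, (-1) ^ (i : ℕ) *
      ((t ^ ((k : ℕ) + 1) - s i ^ ((k : ℕ) + 1)) / ((k : ℕ) + 1)))

lemma measurable_switch (a : ℝ) : Measurable (switch a) :=
  Measurable.ite measurableSet_Iic measurable_const measurable_const

lemma switch_mul_self (a x : ℝ) : switch a x * switch a x = 1 := by
  unfold switch; split_ifs <;> norm_num

lemma abs_switch (a x : ℝ) : |switch a x| = 1 := by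
  unfold switch; split_ifs <;> norm_num

lemma sub_mul_switch (a x : ℝ) : (a - x) * switch a x = |a - x| := by
  unfold switch
  split_ifs with h
  · rw [abs_of_nonneg (by linarith)]; ring
  · rw [abs_of_neg (by linarith)]; ring

lemma measurable_bangBang {d : ℕ} (μ : ℝ) (s : Fin d → ℝ) : Measurable (bangBang μ s) :=
  (Finset.measurable_prod _ fun i _ => measurable_switch (s i)).const_mul μ

lemma abs_bangBang {d : ℕ} {μ : ℝ} (hμ : 0 < μ) (s : Fin d → ℝ) (x : ℝ) :
    |bangBang μ s x| = μ := by
  simp [bangBang, abs_mul, Finset.abs_prod, abs_switch, abs_of_pos hμ]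

lemma isControl_bangBang {d : ℕ} {μ : ℝ} (hμ : 0 < μ) (t : ℝ) (s : Fin d → ℝ) :
    IsControl μ t (bangBang μ s) :=
  ⟨measurable_bangBang μ s, fun x _ => abs_le.1 (abs_bangBang hμ s x).le⟩

lemma prod_sub_mul_prod_switch {ι : Type*} (I : Finset ι) (s : ι → ℝ) (x : ℝ) :
    (∏ i ∈ I, (s i - x)) * ∏ i ∈ I, switch (s i) x = |∏ i ∈ I, (s i - x)| := by
  rw [← Finset.prod_mul_distrib, Finset.abs_prod]
  exact Finset.prod_congr rfl fun i _ => sub_mul_switch _ _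

lemma two_mul_alternating_sum (d : ℕ) :
    2 * ∑ i : Fin d, (-1 : ℝ) ^ (i : ℕ) = 1 - (-1) ^ d := by
  induction d with
  | zero => simp
  | succ n ih =>
    rw [Fin.sum_univ_castSucc, mul_add]
    simp only [Fin.val_castSucc, ih, Fin.val_last, pow_succ]
    ring

/-- Since `s` is monotone, the switches passed before `x` form an initial segment of indices, say of
length `m`; both sides are then `(-1) ^ m`. -/
lemma prod_switch_eq {d : ℕ} {s : Fin d → ℝ} (hs : Monotone s) (x : ℝ) :
    ∏ i, switch (s i) x = 1 - 2 * ∑ i : Fin d, (-1) ^ (i : ℕ) * (Ioi (s i)).indicator 1 x := by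
  induction d with
  | zero => simp
  | succ n ih =>
    by_cases hx : x ≤ s (Fin.last n)
    · rw [Fin.prod_univ_castSucc, Fin.sum_univ_castSucc,
        ih (s := fun i => s i.castSucc) (fun i j h => hs (by simpa using h))]
      simp [switch, hx]
    · have hx' : ∀ i, s i < x := fun i => (hs (Fin.le_last i)).trans_lt (not_le.1 hx)
      have h1 : ∀ i, switch (s i) x = -1 := fun i => if_neg (not_le.2 (hx' i))
      have h2 : ∀ i, (Ioi (s i)).indicator (1 : ℝ → ℝ) x = 1 := fun i =>
        indicator_of_mem (hx' i) _
      simp only [h1, h2, mul_one, two_mul_alternating_sum]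
      simp

lemma integral_pow_mul_indicator {a t : ℝ} (ha : a ∈ Icc 0 t) (k : ℕ) :
    ∫ x in (0 : ℝ)..t, x ^ k * (Ioi a).indicator 1 x = (t ^ (k + 1) - a ^ (k + 1)) / (k + 1) := by
  have h : (fun x : ℝ => x ^ k * (Ioi a).indicator 1 x) = (Ioi a).indicator fun x => x ^ k := by
    ext x
    by_cases hx : x ∈ Ioi a <;> simp [hx]
  rw [h, intervalIntegral.integral_of_le (ha.1.trans ha.2), setIntegral_indicator measurableSet_Ioi]
  have : Ioc 0 t ∩ Ioi a = Ioc a t := by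
    ext x
    simp only [mem_inter_iff, mem_Ioc, mem_Ioi]
    exact ⟨fun h => ⟨h.2, h.1.2⟩, fun h => ⟨⟨ha.1.trans_lt h.1, h.2⟩, h.1⟩⟩
  rw [this, ← intervalIntegral.integral_of_le ha.2, integral_pow]

lemma intervalIntegrable_pow_mul_indicator (a t : ℝ) (k : ℕ) :
    IntervalIntegrable (fun x : ℝ => x ^ k * (Ioi a).indicator 1 x) volume 0 t := by
  have h : (fun x : ℝ => x ^ k * (Ioi a).indicator 1 x) = (Ioi a).indicator fun x => x ^ k := by
    ext x
    by_cases hx : x ∈ Ioi a <;> simp [hx]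
  rw [h]
  have : IntervalIntegrable (fun x : ℝ => x ^ k) volume 0 t :=
    (continuous_pow k).intervalIntegrable _ _
  exact ⟨this.1.indicator measurableSet_Ioi, this.2.indicator measurableSet_Ioi⟩

lemma integral_pow_mul_bangBang {d : ℕ} (μ : ℝ) {t : ℝ} {s : Fin d → ℝ} (hs : Monotone s)
    (hst : ∀ i, s i ∈ Icc 0 t) (k : Fin d) :
    ∫ x in (0 : ℝ)..t, x ^ (k : ℕ) * bangBang μ s x = switchMoments μ t s k := by
  have h : (fun x : ℝ => x ^ (k : ℕ) * bangBang μ s x) = fun x => μ * (x ^ (k : ℕ) -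
      2 * ∑ i : Fin d, (-1) ^ (i : ℕ) * (x ^ (k : ℕ) * (Ioi (s i)).indicator 1 x)) := by
    ext x
    simp only [bangBang, prod_switch_eq hs, Finset.mul_sum, mul_sub, mul_one]
    congr 1
    · exact mul_comm _ _
    · refine Finset.sum_congr rfl fun i _ => ?_
      ring
  have hi : ∀ i ∈ (Finset.univ : Finset (Fin d)), IntervalIntegrable (fun x : ℝ => (-1) ^ (i : ℕ) *
      (x ^ (k : ℕ) * (Ioi (s i)).indicator 1 x)) volume 0 t := fun i _ =>
    (intervalIntegrable_pow_mul_indicator (s i) t k).const_mul _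
  rw [h, intervalIntegral.integral_const_mul, intervalIntegral.integral_sub
    ((continuous_pow _).intervalIntegrable _ _)
    ((by simpa only [Finset.sum_fn] using IntervalIntegrable.sum _ hi :
      IntervalIntegrable _ _ _ _).const_mul 2),
    intervalIntegral.integral_const_mul, intervalIntegral.integral_finsetSum hi]
  simp only [intervalIntegral.integral_const_mul, integral_pow_mul_indicator (hst _), integral_pow]
  simp [switchMoments]

lemma switchMoments_mem_momentSet {d : ℕ} {μ t : ℝ} (hμ : 0 < μ) {s : Fin d → ℝ}
    (hs : Monotone s) (hst : ∀ i, s i ∈ Icc 0 t) : switchMoments μ t s ∈ momentSet d μ t :=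
  ⟨_, isControl_bangBang hμ t s, integral_pow_mul_bangBang μ hs hst⟩

/-! ### Testing controls against polynomials of degree less than `d` -/

lemma intervalIntegrable_of_abs_le {u : ℝ → ℝ} {μ t : ℝ} (hu : Measurable u) (ht : 0 ≤ t)
    (hb : ∀ s ∈ Icc 0 t, |u s| ≤ μ) : IntervalIntegrable u volume 0 t := by
  rw [intervalIntegrable_iff_integrableOn_Icc_of_le ht]
  exact Measure.integrableOn_of_bounded (M := μ) (by simp) hu.aestronglyMeasurable
    ((ae_restrict_iff' measurableSet_Icc).2 (ae_of_all _ fun s hs => hb s hs))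

lemma IsControl.intervalIntegrable {μ t : ℝ} {u : ℝ → ℝ} (hu : IsControl μ t u) (ht : 0 ≤ t) :
    IntervalIntegrable u volume 0 t :=
  intervalIntegrable_of_abs_le hu.1 ht fun s hs => abs_le.2 (hu.2 s hs)

lemma integral_eval_mul {d : ℕ} {t : ℝ} {u : ℝ → ℝ} (hu : IntervalIntegrable u volume 0 t)
    {q : Polynomial ℝ} (hq : q.natDegree < d) :
    ∫ x in (0 : ℝ)..t, q.eval x * u x =
      ∑ k : Fin d, q.coeff k * ∫ x in (0 : ℝ)..t, x ^ (k : ℕ) * u x := by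
  simp only [q.eval_eq_sum_range' hq, Finset.sum_range, Finset.sum_mul, mul_assoc]
  rw [intervalIntegral.integral_finsetSum]
  · simp only [intervalIntegral.integral_const_mul]
  · exact fun k _ => (hu.continuousOn_mul (continuous_pow _).continuousOn).const_mul _

lemma ae_eval_ne_zero {q : Polynomial ℝ} (hq : q ≠ 0) : ∀ᵐ x : ℝ, q.eval x ≠ 0 := by
  have h : {x | q.eval x = 0}.Finite := by
    refine (q.roots.toFinset.finite_toSet).subset fun x hx => ?_
    simpa [hq] using hx
  simpa [ae_iff] using h.measure_zero volume

/-- A function with vanishing moments whose sign agrees with that of a polynomial of degree less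
than `d` vanishes. -/
lemma ae_eq_zero_of_moments_eq_zero {d : ℕ} {t : ℝ} (ht : 0 ≤ t) {w : ℝ → ℝ}
    (hw : IntervalIntegrable w volume 0 t)
    (hm : ∀ k : Fin d, ∫ x in (0 : ℝ)..t, x ^ (k : ℕ) * w x = 0)
    {q : Polynomial ℝ} (hq : q ≠ 0) (hd : q.natDegree < d)
    (hqw : ∀ x ∈ Ioc 0 t, 0 ≤ q.eval x * w x) :
    ∀ᵐ x ∂volume.restrict (Ioc 0 t), w x = 0 := by
  have h0 := integral_eval_mul hw hd
  simp only [hm, mul_zero, Finset.sum_const_zero] at h0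
  rw [intervalIntegral.integral_of_le ht, setIntegral_eq_zero_iff_of_nonneg_ae] at h0
  · filter_upwards [h0, ae_restrict_of_ae (ae_eval_ne_zero hq)] with x hx hx'
    simpa [hx'] using hx
  · exact (ae_restrict_iff' measurableSet_Ioc).2 (ae_of_all _ hqw)
  · exact (hw.continuousOn_mul q.continuous.continuousOn).1

/-- If the bang-bang control `bangBang μ s` maximizes the integral against a nonzero polynomial of
degree less than `d`, then its moment vector is not interior to the moment set. -/
lemma not_mem_interior_momentSet {d : ℕ} {μ t : ℝ} (ht : 0 ≤ t) {v : ℝ → ℝ}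
    (hv : IsControl μ t v) {m : Fin d → ℝ}
    (hm : ∀ k : Fin d, ∫ x in (0 : ℝ)..t, x ^ (k : ℕ) * v x = m k)
    {q : Polynomial ℝ} (hq : q ≠ 0) (hd : q.natDegree < d)
    (hqv : ∀ x ∈ Ioc 0 t, q.eval x * v x = |q.eval x| * μ) :
    m ∉ interior (momentSet d μ t) := by
  intro hmem
  set c : Fin d → ℝ := fun k => q.coeff k with hc
  -- The coefficients of `q` define a linear functional whose maximum over the moment set is
  -- attained at `m`; a small move from an interior `m` along `c` would raise it by `ε * ∑ c k ^ 2`.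
  have hmax : ∀ y ∈ momentSet d μ t, ∑ k, c k * y k ≤ ∑ k, c k * m k := by
    rintro y ⟨u, hu, hy⟩
    have h1 := integral_eval_mul (hu.intervalIntegrable ht) hd
    have h2 := integral_eval_mul (hv.intervalIntegrable ht) hd
    simp only [hy] at h1
    simp only [hm] at h2
    rw [hc, ← h1, ← h2]
    refine intervalIntegral.integral_mono_on_of_le_Ioo ht
      ((hu.intervalIntegrable ht).continuousOn_mul q.continuous.continuousOn)
      ((hv.intervalIntegrable ht).continuousOn_mul q.continuous.continuousOn) fun x hx => ?_
    rw [hqv x (Ioo_subset_Ioc_self hx)]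
    refine (le_abs_self _).trans ?_
    rw [abs_mul]
    exact mul_le_mul_of_nonneg_left (abs_le.2 (hu.2 x (Ioo_subset_Icc_self hx))) (abs_nonneg _)
  have hcont : Tendsto (fun ε : ℝ => m + ε • c) (𝓝 0) (𝓝 m) := by
    have : Continuous fun ε : ℝ => m + ε • c := by fun_prop
    simpa using this.tendsto 0
  have hev : ∀ᶠ ε : ℝ in 𝓝[>] 0, m + ε • c ∈ momentSet d μ t :=
    (hcont.mono_left nhdsWithin_le_nhds).eventually
      (mem_interior_iff_mem_nhds.1 hmem)
  obtain ⟨ε, hε, hε0⟩ := (hev.and self_mem_nhdsWithin).exists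
  have h := hmax _ hε
  simp only [Pi.add_apply, Pi.smul_apply, smul_eq_mul, mul_add, Finset.sum_add_distrib] at h
  have h' : ε * ∑ k, c k ^ 2 ≤ 0 := by
    rw [Finset.mul_sum]
    calc ∑ k, ε * c k ^ 2 = ∑ k, c k * (ε * c k) := Finset.sum_congr rfl fun k _ => by ring
      _ ≤ 0 := by linarith
  have h2 : ∑ k, c k ^ 2 ≤ 0 := nonpos_of_mul_nonpos_right h' hε0
  have h3 := (Finset.sum_eq_zero_iff_of_nonneg fun k _ => sq_nonneg (c k)).1
    (le_antisymm h2 (Finset.sum_nonneg fun k _ => sq_nonneg (c k)))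
  apply hq
  rw [← Polynomial.leadingCoeff_eq_zero, Polynomial.leadingCoeff]
  simpa [hc] using h3 ⟨_, hd⟩ (Finset.mem_univ _)

/-- The polynomial `∏ i ∈ I, (s i - X)`. -/
noncomputable def rootPoly {ι : Type*} (I : Finset ι) (s : ι → ℝ) : Polynomial ℝ :=
  ∏ i ∈ I, (Polynomial.C (s i) - Polynomial.X)

lemma eval_rootPoly {ι : Type*} (I : Finset ι) (s : ι → ℝ) (x : ℝ) :
    (rootPoly I s).eval x = ∏ i ∈ I, (s i - x) := by
  simp [rootPoly, Polynomial.eval_prod]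

lemma rootPoly_ne_zero {ι : Type*} (I : Finset ι) (s : ι → ℝ) : rootPoly I s ≠ 0 := by
  refine Finset.prod_ne_zero_iff.2 fun i _ => ?_
  rw [← neg_sub, neg_ne_zero]
  exact Polynomial.X_sub_C_ne_zero _

lemma natDegree_rootPoly_le {ι : Type*} (I : Finset ι) (s : ι → ℝ) :
    (rootPoly I s).natDegree ≤ I.card := by
  refine (Polynomial.natDegree_prod_le _ _).trans ?_
  rw [Finset.card_eq_sum_ones]
  refine Finset.sum_le_sum fun i _ => ?_
  rw [← Polynomial.natDegree_neg, neg_sub]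
  exact (Polynomial.natDegree_X_sub_C _).le

/-! ### Switching simplices and degenerate switching times -/

/-- Strictly increasing `d`-tuples in the open interval `(0, t)`. -/
def openSimplex (d : ℕ) (t : ℝ) : Set (Fin d → ℝ) := {s | StrictMono s ∧ ∀ i, s i ∈ Ioo 0 t}

/-- Nondecreasing `d`-tuples in the closed interval `[0, t]`. -/
def closedSimplex (d : ℕ) (t : ℝ) : Set (Fin d → ℝ) := {s | Monotone s ∧ ∀ i, s i ∈ Icc 0 t}

lemma openSimplex_subset_closedSimplex (d : ℕ) (t : ℝ) : openSimplex d t ⊆ closedSimplex d t :=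
  fun _ hs => ⟨hs.1.monotone, fun i => Ioo_subset_Icc_self (hs.2 i)⟩

lemma isOpen_openSimplex (d : ℕ) (t : ℝ) : IsOpen (openSimplex d t) := by
  have : openSimplex d t = (⋂ i, ⋂ j, ⋂ (_ : i < j), {s | s i < s j}) ∩
      ⋂ i, {s | 0 < s i} ∩ {s | s i < t} := by
    ext s
    simp [openSimplex, StrictMono]
  rw [this]
  refine IsOpen.inter ?_ ?_
  · exact isOpen_iInter_of_finite fun i => isOpen_iInter_of_finite fun j =>
      isOpen_iInter_of_finite fun _ => isOpen_lt (continuous_apply i) (continuous_apply j)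
  · exact isOpen_iInter_of_finite fun i => (isOpen_lt continuous_const (continuous_apply i)).inter
      (isOpen_lt (continuous_apply i) continuous_const)

lemma isCompact_closedSimplex (d : ℕ) (t : ℝ) : IsCompact (closedSimplex d t) := by
  have h : closedSimplex d t = (Set.univ.pi fun _ => Icc 0 t) ∩
      ⋂ i, ⋂ j, ⋂ (_ : i ≤ j), {s | s i ≤ s j} := by
    ext s
    simp only [closedSimplex, Monotone, mem_ofPred_eq, mem_inter_iff, mem_univ_pi, mem_iInter]
    exact and_comm
  rw [h]
  exact (isCompact_univ_pi fun _ => isCompact_Icc).inter_right <|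
    isClosed_iInter fun i => isClosed_iInter fun j => isClosed_iInter fun _ =>
      isClosed_le (continuous_apply i) (continuous_apply j)

lemma openSimplex_nonempty (d : ℕ) {t : ℝ} (ht : 0 < t) : (openSimplex d t).Nonempty := by
  refine ⟨fun i => t * (((i : ℕ) + 1) / (d + 1)), fun i j hij => ?_, fun i => ⟨by positivity, ?_⟩⟩
  · have : ((i : ℕ) : ℝ) < (j : ℕ) := by exact_mod_cast hij
    simp only
    gcongr
  · have : ((i : ℕ) : ℝ) < d := by exact_mod_cast i.2
    have h : (((i : ℕ) : ℝ) + 1) / (d + 1) < 1 := by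
      rw [div_lt_one (by positivity)]
      linarith
    exact mul_lt_of_lt_one_right ht h

lemma convex_momentSet (d : ℕ) (μ : ℝ) {t : ℝ} (ht : 0 ≤ t) : Convex ℝ (momentSet d μ t) := by
  rintro m ⟨u, hu, hm⟩ m' ⟨v, hv, hm'⟩ a b ha hb hab
  refine ⟨fun s => a * u s + b * v s, ⟨(hu.1.const_mul a).add (hv.1.const_mul b), fun s hs => ?_⟩,
    fun k => ?_⟩
  · exact convex_Icc (-μ) μ (hu.2 s hs) (hv.2 s hs) ha hb hab
  · have h1 := ((hu.intervalIntegrable ht).continuousOn_mul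
      (continuous_pow (k : ℕ)).continuousOn).const_mul a
    have h2 := ((hv.intervalIntegrable ht).continuousOn_mul
      (continuous_pow (k : ℕ)).continuousOn).const_mul b
    simp only [Pi.add_apply, Pi.smul_apply, smul_eq_mul, ← hm, ← hm']
    rw [← intervalIntegral.integral_const_mul, ← intervalIntegral.integral_const_mul,
      ← intervalIntegral.integral_add h1 h2]
    refine intervalIntegral.integral_congr fun s _ => ?_
    ring

/-- The polynomial `ε * ∏ i ∈ I, (s i - x)` has degree `< d` and the sign of the control, so the
control is extremal for it. -/
lemma switchMoments_not_mem_interior_of_prod_eq {d : ℕ} {μ t : ℝ} (hμ : 0 < μ) (ht : 0 ≤ t)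
    {s : Fin d → ℝ} (hs : s ∈ closedSimplex d t) {I : Finset (Fin d)} (hI : I.card < d)
    {ε : ℝ} (hε : |ε| = 1)
    (h : ∀ x ∈ Ioc 0 t, ∏ i, switch (s i) x = ε * ∏ i ∈ I, switch (s i) x) :
    switchMoments μ t s ∉ interior (momentSet d μ t) := by
  have hε0 : ε ≠ 0 := by rintro rfl; simp at hε
  have hεε : ε * ε = 1 := by rw [← abs_mul_abs_self, hε, one_mul]
  refine not_mem_interior_momentSet ht (isControl_bangBang hμ t s)
    (integral_pow_mul_bangBang μ hs.1 hs.2) (q := Polynomial.C ε * rootPoly I s)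
    (mul_ne_zero (by simpa using hε0) (rootPoly_ne_zero I s))
    ((Polynomial.natDegree_C_mul_le _ _).trans_lt ((natDegree_rootPoly_le I s).trans_lt hI))
    fun x hx => ?_
  rw [bangBang, h x hx, Polynomial.eval_mul, Polynomial.eval_C, eval_rootPoly, abs_mul, hε, one_mul,
    ← prod_sub_mul_prod_switch]
  linear_combination μ * (∏ i ∈ I, (s i - x)) * (∏ i ∈ I, switch (s i) x) * hεε

/-- Outside the open simplex a switch is lost: one at `0` only flips the overall sign, one at `t`
has no effect on `(0, t]`, and two coinciding ones cancel. -/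
lemma switchMoments_not_mem_interior {d : ℕ} {μ t : ℝ} (hμ : 0 < μ) (ht : 0 ≤ t)
    {s : Fin d → ℝ} (hs : s ∈ closedSimplex d t) (hs' : s ∉ openSimplex d t) :
    switchMoments μ t s ∉ interior (momentSet d μ t) := by
  have hcard : ∀ i : Fin d, (Finset.univ.erase i).card < d := fun i => by
    simpa using Finset.card_erase_lt_of_mem (Finset.mem_univ i)
  by_cases hinj : Function.Injective s
  · have : ∃ i, s i ∉ Ioo 0 t := by
      by_contra! h
      exact hs' ⟨hs.1.strictMono_of_injective hinj, h⟩
    obtain ⟨i, hi⟩ := this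
    have hor : s i = 0 ∨ s i = t := by
      by_contra! h
      exact hi ⟨lt_of_le_of_ne (hs.2 i).1 h.1.symm, lt_of_le_of_ne (hs.2 i).2 h.2⟩
    rcases hor with h | h
    · refine switchMoments_not_mem_interior_of_prod_eq hμ ht hs (hcard i) (ε := -1) (by simp)
        fun x hx => ?_
      rw [← Finset.mul_prod_erase _ _ (Finset.mem_univ i), switch,
        if_neg (by rw [h]; exact not_le.2 hx.1)]
    · refine switchMoments_not_mem_interior_of_prod_eq hμ ht hs (hcard i) (ε := 1) (by simp)
        fun x hx => ?_
      rw [← Finset.mul_prod_erase _ _ (Finset.mem_univ i), switch, if_pos (by rw [h]; exact hx.2)]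
  · simp only [Function.Injective, not_forall] at hinj
    obtain ⟨i, j, hij, hne⟩ := hinj
    refine switchMoments_not_mem_interior_of_prod_eq hμ ht hs
      (I := (Finset.univ.erase i).erase j)
      ((Finset.card_le_card (Finset.erase_subset _ _)).trans_lt (hcard i)) (ε := 1) (by simp)
      fun x _ => ?_
    rw [← Finset.mul_prod_erase _ _ (Finset.mem_univ i),
      ← Finset.mul_prod_erase _ _ (Finset.mem_erase.2 ⟨Ne.symm hne, Finset.mem_univ j⟩),
      ← mul_assoc, hij, switch_mul_self]

/-! ### Injectivity of the switching parametrisation -/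

lemma bangBang_le_of_ae_eq {d : ℕ} {μ t : ℝ} (hμ : 0 < μ) {s s' : Fin d → ℝ}
    (hs : s ∈ openSimplex d t) (hs' : s' ∈ openSimplex d t)
    (h : ∀ᵐ x ∂volume.restrict (Ioc 0 t), bangBang μ s x = bangBang μ s' x) (i : Fin d)
    (hi : ∀ j < i, s j = s' j) : s' i ≤ s i := by
  by_contra! hlt
  -- Just after `s i`, the `i`-th factors differ while all others agree: earlier switches coincide
  -- and later ones have not yet occurred. The controls thus differ on an interval of positive
  -- length.
  have hev : ∀ᶠ x in 𝓝[>] s i, s i < x ∧ x < s' i ∧ ∀ j, i < j → x < s j := by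
    refine Eventually.and self_mem_nhdsWithin (nhdsWithin_le_nhds ?_)
    refine (eventually_lt_nhds hlt).and (eventually_all.2 fun j => ?_)
    by_cases hj : i < j
    · filter_upwards [eventually_lt_nhds (hs.1 hj)] with x hx _ using hx
    · exact Eventually.of_forall fun x hx => absurd hx hj
  obtain ⟨b, hb, hsub⟩ := (mem_nhdsGT_iff_exists_Ioo_subset).1 hev
  rw [ae_restrict_iff' measurableSet_Ioc] at h
  have hnull : volume (Ioo (s i) b) = 0 := by
    refine measure_mono_null (t := {x | ¬(x ∈ Ioc 0 t → bangBang μ s x = bangBang μ s' x)})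
      (fun x hx hx' => ?_) h
    obtain ⟨h1, h2, h3⟩ := hsub hx
    have heq := hx' ⟨(hs.2 i).1.trans h1, (h2.trans (hs'.2 i).2).le⟩
    simp only [bangBang, mul_eq_mul_left_iff, hμ.ne', or_false] at heq
    rw [← Finset.mul_prod_erase _ _ (Finset.mem_univ i),
      ← Finset.mul_prod_erase _ (fun j => switch (s' j) x) (Finset.mem_univ i)] at heq
    have hrest : ∏ j ∈ Finset.univ.erase i, switch (s j) x =
        ∏ j ∈ Finset.univ.erase i, switch (s' j) x := by
      refine Finset.prod_congr rfl fun j hj => ?_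
      rcases lt_or_gt_of_ne (Finset.ne_of_mem_erase hj) with hj | hj
      · rw [hi j hj]
      · rw [switch, switch, if_pos (h3 j hj).le, if_pos (h2.trans (hs'.1 hj)).le]
    have hne : ∏ j ∈ Finset.univ.erase i, switch (s' j) x ≠ 0 :=
      Finset.prod_ne_zero_iff.2 fun j _ h0 => by simpa [h0] using abs_switch (s' j) x
    rw [hrest, switch, switch, if_neg (not_le.2 h1), if_pos h2.le] at heq
    exact absurd (mul_right_cancel₀ hne heq) (by norm_num)
  simp only [Real.volume_Ioo, ENNReal.ofReal_eq_zero, sub_nonpos] at hnull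
  exact absurd hnull (not_le.2 hb)

lemma eq_of_bangBang_ae_eq {d : ℕ} {μ t : ℝ} (hμ : 0 < μ) {s s' : Fin d → ℝ}
    (hs : s ∈ openSimplex d t) (hs' : s' ∈ openSimplex d t)
    (h : ∀ᵐ x ∂volume.restrict (Ioc 0 t), bangBang μ s x = bangBang μ s' x) : s = s' := by
  have key : ∀ n : ℕ, ∀ i : Fin d, (i : ℕ) = n → s i = s' i := by
    intro n
    induction n using Nat.strong_induction_on with
    | _ n ih =>
      rintro i rfl
      exact le_antisymm
        (bangBang_le_of_ae_eq hμ hs' hs (h.mono fun _ hx => hx.symm) i fun j hj =>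
          (ih j hj j rfl).symm)
        (bangBang_le_of_ae_eq hμ hs hs' h i fun j hj => ih j hj j rfl)
  exact funext fun i => key i i rfl

lemma injOn_switchMoments {d : ℕ} {μ t : ℝ} (hμ : 0 < μ) (ht : 0 ≤ t) :
    InjOn (switchMoments μ t) (openSimplex d t) := by
  intro s hs s' hs' heq
  cases d with
  | zero => exact Subsingleton.elim _ _
  | succ n =>
  wlog h0 : s 0 ≤ s' 0 generalizing s s'
  · exact (this hs' hs heq.symm (not_le.1 h0).le).symm
  refine eq_of_bangBang_ae_eq hμ hs hs' ?_
  have hi := (isControl_bangBang hμ t s).intervalIntegrable ht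
  have hi' := (isControl_bangBang hμ t s').intervalIntegrable ht
  have hc := openSimplex_subset_closedSimplex _ _ hs
  have hc' := openSimplex_subset_closedSimplex _ _ hs'
  have hmom : ∀ k : Fin (n + 1), ∫ x in (0 : ℝ)..t, x ^ (k : ℕ) *
      (bangBang μ s x - bangBang μ s' x) = 0 := fun k => by
    simp only [mul_sub]
    rw [intervalIntegral.integral_sub (hi.continuousOn_mul (continuous_pow _).continuousOn)
      (hi'.continuousOn_mul (continuous_pow _).continuousOn),
      integral_pow_mul_bangBang μ hc.1 hc.2, integral_pow_mul_bangBang μ hc'.1 hc'.2, heq, sub_self]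
  -- Up to `s 0` both controls equal `μ`, because `s 0 ≤ s' 0`. Afterwards the control of `s` has
  -- the sign of this polynomial of degree at most `n`, and subtracting a control of the same
  -- modulus `μ` cannot reverse the sign.
  refine (ae_eq_zero_of_moments_eq_zero ht (hi.sub hi') hmom
    (q := -rootPoly (Finset.univ.erase 0) s) (neg_ne_zero.2 (rootPoly_ne_zero _ _)) ?_
    fun x _ => ?_).mono fun x hx => sub_eq_zero.1 hx
  · rw [Polynomial.natDegree_neg]
    exact (natDegree_rootPoly_le _ _).trans_lt (by simp)
  · rw [Polynomial.eval_neg, eval_rootPoly]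
    by_cases hx : x ≤ s 0
    · have h1 : ∀ i, switch (s i) x = 1 := fun i => if_pos (hx.trans (hc.1 (Fin.zero_le i)))
      have h2 : ∀ i, switch (s' i) x = 1 := fun i =>
        if_pos ((hx.trans h0).trans (hc'.1 (Fin.zero_le i)))
      simp [bangBang, h1, h2]
    · have h1 := prod_sub_mul_prod_switch (Finset.univ.erase 0) s x
      have h2 : bangBang μ s x = -(μ * ∏ i ∈ Finset.univ.erase 0, switch (s i) x) := by
        rw [bangBang, ← Finset.mul_prod_erase _ _ (Finset.mem_univ 0), switch, if_neg hx]
        ring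
      have h3 : -(∏ i ∈ Finset.univ.erase 0, (s i - x)) * bangBang μ s' x ≤
          |∏ i ∈ Finset.univ.erase 0, (s i - x)| * μ := by
        refine (le_abs_self _).trans ?_
        rw [abs_mul, abs_neg, abs_bangBang hμ]
      rw [h2, mul_sub]
      linear_combination h3 - μ * h1

/-! ### Jacobian of the parametrisation and the Vandermonde product -/

/-- The Jacobian matrix of `switchMoments`. -/
noncomputable def momentJacobian {d : ℕ} (μ : ℝ) (s : Fin d → ℝ) : Matrix (Fin d) (Fin d) ℝ :=
  Matrix.of fun k i => 2 * μ * (-1) ^ (i : ℕ) * s i ^ (k : ℕ)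

lemma hasStrictFDerivAt_switchMoments {d : ℕ} (μ t : ℝ) (s : Fin d → ℝ) :
    HasStrictFDerivAt (switchMoments μ t)
      (LinearMap.toContinuousLinearMap (Matrix.toLin' (momentJacobian μ s))) s := by
  rw [hasStrictFDerivAt_pi']
  intro k
  have h1 : ∀ i : Fin d, HasStrictFDerivAt (fun s : Fin d → ℝ => (-1 : ℝ) ^ (i : ℕ) *
      ((t ^ ((k : ℕ) + 1) - s i ^ ((k : ℕ) + 1)) / ((k : ℕ) + 1)))
      (((-1 : ℝ) ^ (i : ℕ) * (-(s i ^ (k : ℕ)))) • ContinuousLinearMap.proj (R := ℝ) i) s := by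
    intro i
    have hg : HasStrictDerivAt (fun y : ℝ => (-1 : ℝ) ^ (i : ℕ) *
        ((t ^ ((k : ℕ) + 1) - y ^ ((k : ℕ) + 1)) / ((k : ℕ) + 1)))
        ((-1 : ℝ) ^ (i : ℕ) * (-(s i ^ (k : ℕ)))) (s i) := by
      have h := (((hasStrictDerivAt_pow ((k : ℕ) + 1) (s i)).const_sub
        (t ^ ((k : ℕ) + 1))).div_const ((k : ℕ) + 1 : ℝ)).const_mul ((-1 : ℝ) ^ (i : ℕ))
      refine h.congr_deriv ?_
      have : ((k : ℕ) : ℝ) + 1 ≠ 0 := by positivity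
      rw [Nat.add_sub_cancel, Nat.cast_succ, neg_div, mul_div_cancel_left₀ _ this]
    exact HasStrictDerivAt.comp_hasStrictFDerivAt (f := fun s : Fin d → ℝ => s i) s hg
      (hasStrictFDerivAt_apply i s)
  have h2 := (((HasStrictFDerivAt.fun_sum (u := Finset.univ) fun i _ => h1 i).const_mul 2).const_sub
    (t ^ ((k : ℕ) + 1) / ((k : ℕ) + 1))).const_mul μ
  refine h2.congr_fderiv ?_
  ext v
  simp only [momentJacobian, smul_apply, neg_apply,
    sum_apply, ContinuousLinearMap.proj_apply, smul_eq_mul,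
    ContinuousLinearMap.comp_apply, LinearMap.coe_toContinuousLinearMap', Matrix.toLin'_apply,
    Matrix.mulVec, dotProduct, Matrix.of_apply, Finset.mul_sum, ← Finset.sum_neg_distrib]
  refine Finset.sum_congr rfl fun i _ => ?_
  ring

/-- The Vandermonde product `∏_{i < j} (s j - s i)`. -/
noncomputable def vandermondeProd {d : ℕ} (s : Fin d → ℝ) : ℝ :=
  ∏ i, ∏ j ∈ Finset.Ioi i, (s j - s i)

lemma vandermondeProd_pos {d : ℕ} {s : Fin d → ℝ} (hs : StrictMono s) : 0 < vandermondeProd s :=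
  Finset.prod_pos fun _ _ => Finset.prod_pos fun _ hj => sub_pos.2 (hs (Finset.mem_Ioi.1 hj))

lemma continuous_vandermondeProd (d : ℕ) :
    Continuous (vandermondeProd : (Fin d → ℝ) → ℝ) := by
  unfold vandermondeProd
  fun_prop

lemma abs_det_momentJacobian {d : ℕ} {μ : ℝ} (hμ : 0 < μ) (s : Fin d → ℝ) :
    |(momentJacobian μ s).det| = (2 * μ) ^ d * |vandermondeProd s| := by
  have : momentJacobian μ s = (Matrix.vandermonde s)ᵀ *
      Matrix.diagonal fun i : Fin d => 2 * μ * (-1) ^ (i : ℕ) := by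
    ext k i
    simp [momentJacobian, Matrix.vandermonde_apply]
    ring
  rw [this, Matrix.det_mul, Matrix.det_transpose, Matrix.det_vandermonde, Matrix.det_diagonal,
    abs_mul, Finset.abs_prod _ (fun i : Fin d => 2 * μ * (-1) ^ (i : ℕ))]
  simp [abs_mul, abs_of_pos hμ, vandermondeProd, mul_comm]

lemma det_momentJacobian_ne_zero {d : ℕ} {μ t : ℝ} (hμ : 0 < μ) {s : Fin d → ℝ}
    (hs : s ∈ openSimplex d t) : (momentJacobian μ s).det ≠ 0 := by
  rw [← abs_pos, abs_det_momentJacobian hμ]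
  have := abs_pos.2 (vandermondeProd_pos hs.1).ne'
  positivity

/-- Distinct nodes make the Vandermonde determinant nonzero, so the map is strictly differentiable
with surjective derivative, hence locally open. -/
lemma isOpen_image_switchMoments {d : ℕ} {μ : ℝ} (hμ : 0 < μ) (t : ℝ) :
    IsOpen (switchMoments μ t '' openSimplex d t) := by
  rw [isOpen_iff_mem_nhds]
  rintro _ ⟨s, hs, rfl⟩
  have hsurj : (LinearMap.toContinuousLinearMap (Matrix.toLin' (momentJacobian μ s))).range = ⊤ := by
    rw [LinearMap.coe_toContinuousLinearMap, LinearMap.range_eq_top]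
    have hu : IsUnit (momentJacobian μ s) :=
      (Matrix.isUnit_iff_isUnit_det _).2 (isUnit_iff_ne_zero.2 (det_momentJacobian_ne_zero hμ hs))
    intro y
    simpa [Matrix.toLin'_apply] using Matrix.mulVec_surjective_iff_isUnit.2 hu y
  rw [← (hasStrictFDerivAt_switchMoments μ t s).map_nhds_eq_of_surj hsurj]
  exact image_mem_map ((isOpen_openSimplex d t).mem_nhds hs)

lemma continuous_switchMoments {d : ℕ} (μ t : ℝ) :
    Continuous (switchMoments μ t : (Fin d → ℝ) → Fin d → ℝ) := by
  unfold switchMoments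
  fun_prop

/-! ### Interior and volume of the moment set -/

/-- The interior of the moment set consists of the moment vectors of bang-bang controls with
exactly `d` switches. -/
lemma interior_momentSet {d : ℕ} {μ t : ℝ} (hμ : 0 < μ) (ht : 0 < t) :
    interior (momentSet d μ t) = switchMoments μ t '' openSimplex d t := by
  have hsub : switchMoments μ t '' openSimplex d t ⊆ interior (momentSet d μ t) := by
    refine interior_maximal ?_ (isOpen_image_switchMoments hμ t)
    rintro _ ⟨s, hs, rfl⟩
    have := openSimplex_subset_closedSimplex _ _ hs
    exact switchMoments_mem_momentSet hμ this.1 this.2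
  refine Subset.antisymm ?_ hsub
  -- A nonempty open subset that is relatively closed in the connected interior fills it. Closure
  -- points of the image come from the compact closed simplex.
  refine (convex_momentSet d μ ht.le).interior.isPreconnected.subset_of_closure_inter_subset
    (isOpen_image_switchMoments hμ t) ?_ ?_
  · rw [inter_eq_right.2 hsub]
    exact (openSimplex_nonempty d ht).image _
  · rintro y ⟨hy, hyi⟩
    have hclosed : IsClosed (switchMoments μ t '' closedSimplex d t) :=
      ((isCompact_closedSimplex d t).image (continuous_switchMoments μ t)).isClosed
    obtain ⟨s, hs, rfl⟩ := closure_minimal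
      (image_mono (openSimplex_subset_closedSimplex d t)) hclosed hy
    by_contra h
    exact switchMoments_not_mem_interior hμ ht.le hs (fun hs' => h ⟨s, hs', rfl⟩) hyi

lemma volume_momentSet {d : ℕ} {μ t : ℝ} (hμ : 0 < μ) (ht : 0 < t) :
    volume (momentSet d μ t) =
      ENNReal.ofReal ((2 * μ) ^ d * ∫ s in openSimplex d t, vandermondeProd s) := by
  have hmeas : MeasurableSet (openSimplex d t) := (isOpen_openSimplex d t).measurableSet
  have h1 : volume (momentSet d μ t) = volume (interior (momentSet d μ t)) :=
    (measure_congr (interior_ae_eq_of_null_frontier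
      ((convex_momentSet d μ ht.le).addHaar_frontier volume))).symm
  rw [h1, interior_momentSet hμ ht, ← lintegral_abs_det_fderiv_eq_addHaar_image volume hmeas
    (fun s _ => (hasStrictFDerivAt_switchMoments μ t s).hasFDerivAt.hasFDerivWithinAt)
    (injOn_switchMoments hμ ht.le), ← integral_const_mul, ofReal_integral_eq_lintegral_ofReal]
  · refine setLIntegral_congr_fun hmeas fun s hs => ?_
    simp only [ContinuousLinearMap.det, LinearMap.coe_toContinuousLinearMap, LinearMap.det_toLin']
    rw [abs_det_momentJacobian hμ, abs_of_pos (vandermondeProd_pos hs.1)]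
  · refine (ContinuousOn.integrableOn_compact (isCompact_closedSimplex d t) ?_).mono_set
      (openSimplex_subset_closedSimplex d t)
    exact ((continuous_vandermondeProd d).const_mul _).continuousOn
  · refine (ae_restrict_iff' hmeas).2 (ae_of_all _ fun s hs => ?_)
    have := vandermondeProd_pos hs.1
    simp only [Pi.zero_apply]
    positivity

lemma vandermondeProd_smul {d : ℕ} (c : ℝ) (s : Fin d → ℝ) :
    vandermondeProd (c • s) = c ^ (d * (d - 1) / 2) * vandermondeProd s := by
  have hexp : ∑ i : Fin d, (Finset.Ioi i).card = d * (d - 1) / 2 := by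
    simp only [Fin.card_Ioi]
    rw [← Finset.sum_range_id, ← Finset.sum_range_reflect, Finset.sum_range]
  simp only [vandermondeProd, Pi.smul_apply, smul_eq_mul, ← mul_sub, Finset.prod_mul_distrib,
    Finset.prod_const, Finset.prod_pow_eq_pow_sum, hexp]

lemma triangle_eq (d : ℕ) : d * (d + 1) / 2 = d * (d - 1) / 2 + d := by
  have := Nat.triangle_succ d
  rw [mul_comm]
  simpa using this

/-- The exponent combines `d` from scaling Lebesgue measure with `d * (d - 1) / 2` from the
homogeneity of the Vandermonde product. -/
lemma setIntegral_vandermondeProd_openSimplex (d : ℕ) {t : ℝ} (ht : 0 < t) :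
    ∫ s in openSimplex d t, vandermondeProd s =
      t ^ (d * (d + 1) / 2) * ∫ s in openSimplex d 1, vandermondeProd s := by
  have hset : t • openSimplex d 1 = openSimplex d t := by
    ext s
    rw [mem_smul_set_iff_inv_smul_mem₀ ht.ne']
    have h1 : ∀ i j, t⁻¹ * s i < t⁻¹ * s j ↔ s i < s j := fun i j =>
      mul_lt_mul_iff_right₀ (inv_pos.2 ht)
    have h2 : ∀ i, 0 < t⁻¹ * s i ↔ 0 < s i := fun i => mul_pos_iff_of_pos_left (inv_pos.2 ht)
    have h3 : ∀ i, t⁻¹ * s i < 1 ↔ s i < t := fun i => by rw [inv_mul_lt_one₀ ht]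
    simp [openSimplex, StrictMono, h1, h2, h3]
  have h := Measure.setIntegral_comp_smul_of_pos volume (vandermondeProd (d := d))
    (openSimplex d 1) ht
  simp only [vandermondeProd_smul, integral_const_mul, hset, Module.finrank_fin_fun,
    smul_eq_mul] at h
  rw [triangle_eq, pow_add]
  have h0 : t ^ d ≠ 0 := by positivity
  field_simp at h
  linear_combination -h

/-! ### Lattice sums as Riemann sums -/

/-- Strictly increasing `d`-tuples in the closed unit interval. -/
def unitSimplex (d : ℕ) : Set (Fin d → ℝ) := {s | StrictMono s ∧ ∀ i, s i ∈ Icc 0 1}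

lemma convex_unitSimplex (d : ℕ) : Convex ℝ (unitSimplex d) := by
  rintro s hs s' hs' a b ha hb hab
  refine ⟨fun i j hij => ?_, fun i => convex_Icc 0 1 (hs.2 i) (hs'.2 i) ha hb hab⟩
  have h1 := hs.1 hij
  have h2 := hs'.1 hij
  simp only [Pi.add_apply, Pi.smul_apply, smul_eq_mul]
  rcases ha.eq_or_lt with rfl | ha
  · have : b = 1 := by linarith
    simpa [this] using h2
  · have := mul_lt_mul_of_pos_left h1 ha
    have := mul_le_mul_of_nonneg_left h2.le hb
    linarith

lemma measurableSet_unitSimplex (d : ℕ) : MeasurableSet (unitSimplex d) := by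
  have : unitSimplex d = (⋂ i, ⋂ j, ⋂ (_ : i < j), {s | s i < s j}) ∩
      Set.univ.pi fun _ => Icc 0 1 := by
    ext s
    simp only [unitSimplex, StrictMono, mem_ofPred_eq, mem_inter_iff, mem_univ_pi, mem_iInter]
  rw [this]
  exact (MeasurableSet.iInter fun i => MeasurableSet.iInter fun j => MeasurableSet.iInter fun _ =>
    measurableSet_lt (measurable_pi_apply i) (measurable_pi_apply j)).inter
    (MeasurableSet.univ_pi fun _ => measurableSet_Icc)

lemma isBounded_unitSimplex (d : ℕ) : Bornology.IsBounded (unitSimplex d) :=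
  (isCompact_univ_pi fun _ => isCompact_Icc).isBounded.subset
    (fun _ hs => mem_univ_pi.2 hs.2 : unitSimplex d ⊆ Set.univ.pi fun _ => Icc 0 1)

/-- The lattice sum allows the indices `0` and `n`, which forces the closed interval; the extra
points lie on finitely many null hyperplanes. -/
lemma unitSimplex_ae_eq (d : ℕ) : unitSimplex d =ᵐ[volume] openSimplex d 1 := by
  have hsub : openSimplex d 1 ⊆ unitSimplex d := fun s hs =>
    ⟨hs.1, fun i => Ioo_subset_Icc_self (hs.2 i)⟩
  have hne : ∀ c : ℝ, ∀ᵐ s : Fin d → ℝ, ∀ i, s i ≠ c := fun c => by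
    refine ae_all_iff.2 fun i => ?_
    have := Measure.pi_hyperplane (fun _ : Fin d => (volume : Measure ℝ)) i c
    rw [← volume_pi] at this
    simpa [ae_iff] using this
  filter_upwards [hne 0, hne 1] with s h0 h1
  refine propext ⟨fun hs => ?_, fun hs => hsub hs⟩
  exact ⟨hs.1, fun i => ⟨lt_of_le_of_ne (hs.2 i).1 (h0 i).symm, lt_of_le_of_ne (hs.2 i).2 (h1 i)⟩⟩

lemma vandermondeSum_eq (d n : ℕ) : vandermondeSum d n =
    ∑ i : Fin d → Fin (n + 1) with ∀ α β, α < β → i α < i β,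
      vandermondeProd fun α => ((i α : ℕ) : ℝ) := by
  refine Finset.sum_congr rfl fun i _ => ?_
  rw [vandermondeProd, Finset.prod_filter, Fintype.prod_prod_type]
  refine Finset.prod_congr rfl fun α _ => ?_
  rw [← Finset.prod_filter]
  exact Finset.prod_congr (by ext; simp) fun _ _ => rfl

lemma unitSimplex_inter_lattice (d : ℕ) {n : ℕ} (hn : n ≠ 0) :
    unitSimplex d ∩ ((n : ℝ)⁻¹ • (Submodule.span ℤ (Set.range (Pi.basisFun ℝ (Fin d)))) :
      Set (Fin d → ℝ)) =
    (fun i : Fin d → Fin (n + 1) => (n : ℝ)⁻¹ • fun α => ((i α : ℕ) : ℝ)) ''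
      ((Finset.univ.filter fun i : Fin d → Fin (n + 1) => ∀ α β, α < β → i α < i β :
        Finset (Fin d → Fin (n + 1))) : Set (Fin d → Fin (n + 1))) := by
  have : NeZero n := ⟨hn⟩
  have hn0 : (0 : ℝ) < n := by positivity
  ext s
  rw [mem_inter_iff]
  have hmem := BoxIntegral.unitPartition.mem_smul_span_iff (n := n) (v := s)
  constructor
  · rintro ⟨hs, hl⟩
    have hl' := hmem.1 hl
    choose z hz using hl'
    have hz' : ∀ i, (z i : ℝ) = n * s i := hz
    have hz0 : ∀ i, 0 ≤ z i := fun i => by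
      have : (0 : ℝ) ≤ z i := by
        rw [hz']
        exact mul_nonneg hn0.le (hs.2 i).1
      exact_mod_cast this
    have hzn : ∀ i, z i ≤ n := fun i => by
      have : (z i : ℝ) ≤ n := by
        rw [hz']
        exact mul_le_of_le_one_right hn0.le (hs.2 i).2
      exact_mod_cast this
    have hcast : ∀ i, (((z i).toNat : ℕ) : ℝ) = n * s i := fun i => by
      rw [← hz', ← Int.cast_natCast, Int.toNat_of_nonneg (hz0 i)]
    refine ⟨fun i => ⟨(z i).toNat, by have := hz0 i; have := hzn i; omega⟩, ?_, ?_⟩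
    · simp only [Finset.coe_filter, Finset.mem_univ, true_and, mem_ofPred_eq, Fin.mk_lt_mk]
      intro α β hαβ
      have h : (((z α).toNat : ℕ) : ℝ) < ((z β).toNat : ℕ) := by
        rw [hcast, hcast]
        exact mul_lt_mul_of_pos_left (hs.1 hαβ) hn0
      exact_mod_cast h
    · ext i
      simp only [Pi.smul_apply, smul_eq_mul, hcast]
      field_simp
  · rintro ⟨i, hi, rfl⟩
    simp only [Finset.coe_filter, Finset.mem_univ, true_and, mem_ofPred_eq] at hi
    refine ⟨⟨fun α β hαβ => ?_, fun α => ⟨by simp only [Pi.smul_apply, smul_eq_mul]; positivity, ?_⟩⟩,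
      hmem.2 fun α => ⟨(i α : ℕ), ?_⟩⟩
    · have : ((i α : ℕ) : ℝ) < (i β : ℕ) := by exact_mod_cast hi α β hαβ
      simp only [Pi.smul_apply, smul_eq_mul]
      gcongr
    · simp only [Pi.smul_apply, smul_eq_mul]
      rw [inv_mul_le_one₀ hn0]
      exact_mod_cast Nat.lt_succ_iff.1 (i α).2
    · simp only [Pi.smul_apply, smul_eq_mul]
      field_simp
      exact map_natCast _ _

lemma tendsto_vandermondeSum (d : ℕ) :
    Tendsto (fun n : ℕ => 1 / (n : ℝ) ^ (d * (d + 1) / 2) * vandermondeSum d n) atTop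
      (𝓝 (∫ s in openSimplex d 1, vandermondeProd s)) := by
  -- Riemann sums over `n⁻¹ ℤ^d` converge because the simplex is bounded and, being convex, has null
  -- frontier. Homogeneity then moves `n` out of the Vandermonde product.
  have h := tendsto_tsum_div_pow_atTop_integral (unitSimplex d) vandermondeProd
    (continuous_vandermondeProd d) (isBounded_unitSimplex d) (measurableSet_unitSimplex d)
    ((convex_unitSimplex d).addHaar_frontier volume)
  rw [setIntegral_congr_set (unitSimplex_ae_eq d)] at h
  refine h.congr' ?_
  filter_upwards [eventually_ne_atTop 0] with n hn
  have hn0 : (0 : ℝ) < n := by positivity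
  have hinj : Function.Injective
      (fun i : Fin d → Fin (n + 1) => (n : ℝ)⁻¹ • fun α => ((i α : ℕ) : ℝ)) := by
    intro i j hij
    ext α
    have := congrFun hij α
    simpa [hn] using this
  rw [unitSimplex_inter_lattice d hn, tsum_image _ hinj.injOn,
    Finset.tsum_subtype' _ fun i : Fin d → Fin (n + 1) =>
      vandermondeProd ((n : ℝ)⁻¹ • fun α => ((i α : ℕ) : ℝ)),
    vandermondeSum_eq, triangle_eq, Fintype.card_fin]
  simp only [vandermondeProd_smul, ← Finset.mul_sum]
  rw [pow_add, inv_pow]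
  field_simp

/-! ### Solving the control system -/

/-- Taylor's formula with integral remainder for a chain of absolutely continuous functions, each
of which is almost everywhere the derivative of the preceding one. -/
lemma taylor_of_absolutelyContinuous {t : ℝ} (ht : 0 ≤ t) (y : ℕ → ℝ → ℝ) (m : ℕ)
    (hac : ∀ k ≤ m, AbsolutelyContinuousOnInterval (y k) 0 t)
    (hder : ∀ k ≤ m, ∀ᵐ s, s ∈ Icc 0 t → HasDerivAt (y k) (y (k + 1) s) s) :
    y 0 t = ∑ k ∈ Finset.range (m + 1), t ^ k / k.factorial * y k 0 +
      ∫ s in (0 : ℝ)..t, (t - s) ^ m / m.factorial * y (m + 1) s := by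
  have hderiv : ∀ k ≤ m, ∀ᵐ s, s ∈ uIoc 0 t → deriv (y k) s = y (k + 1) s := fun k hk => by
    filter_upwards [hder k hk] with s hs hs'
    rw [uIoc_of_le ht] at hs'
    exact (hs (Ioc_subset_Icc_self hs')).deriv
  induction m with
  | zero =>
    have h := (hac 0 le_rfl).integral_deriv_eq_sub
    rw [intervalIntegral.integral_congr_ae (hderiv 0 le_rfl)] at h
    simp only [zero_add] at h
    simp [h]
  | succ m ih =>
    rw [ih (fun k hk => hac k (hk.trans m.le_succ)) (fun k hk => hder k (hk.trans m.le_succ))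
      (fun k hk => hderiv k (hk.trans m.le_succ)), Finset.sum_range_succ _ (m + 1), add_assoc]
    congr 1
    -- This primitive of the kernel vanishes at `t`, so integration by parts leaves only the
    -- boundary term at `0`, which is the next Taylor term.
    set f : ℝ → ℝ := fun s => -((t - s) ^ (m + 1) / (m + 1).factorial) with hf
    have hf' : ∀ s, HasDerivAt f ((t - s) ^ m / m.factorial) s := fun s => by
      have h := ((((hasDerivAt_id s).const_sub t).pow (m + 1)).div_const
        ((m + 1).factorial : ℝ)).neg
      refine h.congr_deriv ?_
      have : ((m.factorial : ℕ) : ℝ) ≠ 0 := by positivity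
      have : (m : ℝ) + 1 ≠ 0 := by positivity
      simp only [id, Nat.factorial_succ, Nat.add_sub_cancel]
      push_cast
      field_simp
    have hfac : AbsolutelyContinuousOnInterval f 0 t :=
      ContDiffOn.absolutelyContinuousOnInterval (by rw [hf]; fun_prop)
    have h := hfac.integral_mul_deriv_eq_deriv_mul (hac (m + 1) le_rfl)
    simp only [(hf' _).deriv] at h
    have hcongr : ∫ s in (0 : ℝ)..t, f s * deriv (y (m + 1)) s =
        ∫ s in (0 : ℝ)..t, f s * y (m + 1 + 1) s := by
      refine intervalIntegral.integral_congr_ae ?_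
      filter_upwards [hderiv (m + 1) le_rfl] with s hs hs'
      rw [hs hs']
    rw [hcongr] at h
    simp only [hf, neg_mul, intervalIntegral.integral_neg, sub_self, sub_zero] at h
    simp only [ne_eq, Nat.succ_ne_zero, not_false_eq_true, zero_pow, zero_div, zero_mul] at h
    linarith

lemma stateMatrix_mulVec_add_apply {d : ℕ} (x : Fin d → ℝ) (c : ℝ) (j : Fin d) :
    (stateMatrix d *ᵥ x + c • inputVector d) j =
      if h : (j : ℕ) + 1 < d then x ⟨j + 1, h⟩ else c := by
  simp only [stateMatrix, inputVector, Pi.add_apply, Pi.smul_apply, smul_eq_mul, Matrix.mulVec,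
    dotProduct, Matrix.of_apply, ite_mul, one_mul, zero_mul]
  split_ifs with h1 h2 h2
  · omega
  · rw [Finset.sum_eq_zero]
    · simp
    · intro k _
      rw [if_neg]
      have := k.2
      omega
  · rw [Finset.sum_eq_single ⟨j + 1, h2⟩]
    · simp
    · intro k _ hk
      rw [if_neg]
      rintro h
      exact hk (Fin.ext h.symm)
    · simp
  · have := j.2
    omega

/-- The free evolution `e^{tA} x₀`. -/
noncomputable def freeEvolution {d : ℕ} (t : ℝ) (x₀ : Fin d → ℝ) (i : Fin d) : ℝ :=
  ∑ k ∈ Finset.range (d - 1 - i + 1),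
    t ^ k / k.factorial * if h : (i : ℕ) + k < d then x₀ ⟨i + k, h⟩ else 0

lemma IsTrajectory.apply_eq {d : ℕ} {t : ℝ} (ht : 0 ≤ t) {u : ℝ → ℝ} {x : ℝ → Fin d → ℝ}
    (hx : IsTrajectory d t u x) (i : Fin d) :
    x t i = freeEvolution t (x 0) i +
      ∫ s in (0 : ℝ)..t, (t - s) ^ (d - 1 - (i : ℕ)) / (d - 1 - (i : ℕ)).factorial * u s := by
  -- The chain of successive derivatives of coordinate `i`; it reaches the control exactly at `k = d
  -- - i`.
  set y : ℕ → ℝ → ℝ := fun k s => if h : (i : ℕ) + k < d then x s ⟨i + k, h⟩ else u s with hy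
  have hi := i.2
  have hlt : ∀ k ≤ d - 1 - (i : ℕ), (i : ℕ) + k < d := fun k hk => by omega
  have hyk : ∀ k (hk : (i : ℕ) + k < d), y k = fun s => x s ⟨i + k, hk⟩ := fun k hk => by
    ext s
    simp only [hy, dif_pos hk]
  have h := taylor_of_absolutelyContinuous ht y (d - 1 - i) (fun k hk => ?_) fun k hk => ?_
  · have h0 : y 0 t = x t i := by simp [hy]
    have hlast : y (d - 1 - i + 1) = u := by
      ext s
      simp only [hy]
      rw [dif_neg (by omega)]
    rw [h0, hlast] at h
    rw [h, freeEvolution]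
    congr 1
    refine Finset.sum_congr rfl fun k hk => ?_
    have hk' := hlt k (Nat.lt_succ_iff.1 (Finset.mem_range.1 hk))
    rw [dif_pos hk', hyk k hk']
  · rw [hyk k (hlt k hk)]
    exact hx.1 _
  · rw [hyk k (hlt k hk)]
    filter_upwards [(ae_restrict_iff' measurableSet_Icc).1 hx.2] with s hs hs'
    refine (hasDerivAt_pi.1 (hs hs') ⟨i + k, hlt k hk⟩).congr_deriv ?_
    rw [stateMatrix_mulVec_add_apply]
    rfl

/-- Iterated primitives of `u` with prescribed values `c n` at `0`. -/
noncomputable def iteratedPrimitive (c : ℕ → ℝ) (u : ℝ → ℝ) : ℕ → ℝ → ℝ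
  | 0 => u
  | n + 1 => fun s => c n + ∫ r in (0 : ℝ)..s, iteratedPrimitive c u n r

lemma locallyIntegrable_iteratedPrimitive (c : ℕ → ℝ) {u : ℝ → ℝ} (hu : LocallyIntegrable u)
    (n : ℕ) : LocallyIntegrable (iteratedPrimitive c u n) := by
  induction n with
  | zero => exact hu
  | succ n ih =>
    have : Continuous (iteratedPrimitive c u (n + 1)) :=
      continuous_const.add (intervalIntegral.continuous_primitive
        (fun a b => (ih.integrableOn_isCompact isCompact_uIcc).intervalIntegrable) 0)
    exact this.locallyIntegrable

lemma exists_isTrajectory {d : ℕ} {μ t : ℝ} (ht : 0 ≤ t) {u : ℝ → ℝ} (hu : IsControl μ t u)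
    (x₀ : Fin d → ℝ) : ∃ x, IsTrajectory d t u x ∧ x 0 = x₀ := by
  -- Nothing bounds `u` outside `[0, t]`, so it is cut off to become integrable.
  set v : ℝ → ℝ := (Icc 0 t).indicator u with hv
  have hvi : LocallyIntegrable v := by
    refine Integrable.locallyIntegrable ?_
    rw [hv, integrable_indicator_iff measurableSet_Icc,
      ← intervalIntegrable_iff_integrableOn_Icc_of_le ht]
    exact hu.intervalIntegrable ht
  -- Coordinate `i` will be the primitive of order `d - i`, whose initial value is `c (d - 1 - i) =
  -- x₀ i`.
  set c : ℕ → ℝ := fun n => if h : d - 1 - n < d then x₀ ⟨d - 1 - n, h⟩ else 0 with hc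
  set z := iteratedPrimitive c v with hz
  have hzi := locallyIntegrable_iteratedPrimitive c hvi
  refine ⟨fun s i => z (d - i) s, ⟨fun i => ?_, ?_⟩, ?_⟩
  · have hi : d - (i : ℕ) = d - 1 - i + 1 := by have := i.2; omega
    simp only [hi]
    exact (LipschitzOnWith.absolutelyContinuousOnInterval
      ((LipschitzWith.const (c (d - 1 - i))).lipschitzOnWith)).fun_add
      (IntervalIntegrable.absolutelyContinuousOnInterval_intervalIntegral
      ((hzi (d - 1 - i)).integrableOn_isCompact isCompact_uIcc).intervalIntegrable left_mem_uIcc)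
  · rw [ae_restrict_iff' measurableSet_Icc]
    have hall := ae_all_iff.2 fun n => LocallyIntegrable.ae_hasDerivAt_integral (hzi n)
    filter_upwards [hall] with s hs hst
    rw [hasDerivAt_pi]
    intro i
    have hi : d - (i : ℕ) = d - 1 - i + 1 := by have := i.2; omega
    rw [stateMatrix_mulVec_add_apply]
    simp only [hi]
    refine ((hs (d - 1 - i) 0).const_add (c (d - 1 - i))).congr_deriv ?_
    split_ifs with h
    · rw [hz, show d - 1 - (i : ℕ) = d - (i + 1) by omega]
    · rw [show d - 1 - (i : ℕ) = 0 by omega]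
      exact indicator_of_mem hst u
  · ext i
    have hi : d - (i : ℕ) = d - 1 - i + 1 := by have := i.2; omega
    have h1 : d - 1 - (d - 1 - (i : ℕ)) = i := by have := i.2; omega
    simp only [hi, hz, iteratedPrimitive, intervalIntegral.integral_same, add_zero, hc]
    simp [h1]

/-! ### Time reversal and the affine map from moments to states -/

lemma IsControl.comp_sub {μ t : ℝ} {u : ℝ → ℝ} (hu : IsControl μ t u) :
    IsControl μ t fun s => u (t - s) :=
  ⟨hu.1.comp (measurable_const.sub measurable_id), fun s hs =>
    hu.2 _ ⟨sub_nonneg.2 hs.2, sub_le_self _ hs.1⟩⟩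

lemma integral_sub_pow_mul (t : ℝ) (u : ℝ → ℝ) (m : ℕ) :
    ∫ s in (0 : ℝ)..t, (t - s) ^ m / m.factorial * u s =
      (m.factorial : ℝ)⁻¹ * ∫ s in (0 : ℝ)..t, s ^ m * u (t - s) := by
  have h := intervalIntegral.integral_comp_sub_left (a := 0) (b := t)
    (fun s => s ^ m * u (t - s)) t
  simp only [sub_sub_cancel, sub_self, sub_zero] at h
  rw [← h, ← intervalIntegral.integral_const_mul]
  refine intervalIntegral.integral_congr fun _ _ => ?_
  ring

/-- The linear part of the affine map that takes moment vectors to reachable states. -/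
noncomputable def momentMatrix (d : ℕ) : Matrix (Fin d) (Fin d) ℝ :=
  (Matrix.diagonal fun k : Fin d => ((k : ℕ).factorial : ℝ)⁻¹).submatrix Fin.revPerm id

lemma momentMatrix_mulVec {d : ℕ} (m : Fin d → ℝ) (i : Fin d) :
    (momentMatrix d *ᵥ m) i = ((d - 1 - (i : ℕ)).factorial : ℝ)⁻¹ * m i.rev := by
  have : d - ((i : ℕ) + 1) = d - 1 - i := by omega
  simp [momentMatrix, Matrix.mulVec, dotProduct, Matrix.submatrix_apply, Matrix.diagonal_apply,
    this]

/-- The row reversal contributes only a sign, and `0! = 1` lets the product start at `1`. -/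
lemma abs_det_momentMatrix (d : ℕ) :
    |(momentMatrix d).det| = (∏ k ∈ Finset.Icc 1 (d - 1), (k.factorial : ℝ))⁻¹ := by
  have h : ∏ k : Fin d, ((k : ℕ).factorial : ℝ) =
      ∏ k ∈ Finset.Icc 1 (d - 1), (k.factorial : ℝ) := by
    cases d with
    | zero => simp
    | succ n =>
      rw [← Finset.prod_range fun k => (k.factorial : ℝ), Nat.add_sub_cancel]
      induction n with
      | zero => simp
      | succ n ih => rw [Finset.prod_range_succ, ih, Finset.prod_Icc_succ_top (by omega)]
  have hpos : 0 < ∏ k : Fin d, ((k : ℕ).factorial : ℝ) :=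
    Finset.prod_pos fun k _ => by positivity
  rw [momentMatrix, Matrix.det_permute, Matrix.det_diagonal, Finset.prod_inv_distrib, abs_mul,
    ← h, abs_of_pos (inv_pos.2 hpos)]
  rcases Int.units_eq_one_or (Equiv.Perm.sign (Fin.revPerm : Equiv.Perm (Fin d))) with h | h <;>
    simp [h]

/-- Taylor's formula determines the endpoint of every trajectory, and `exists_isTrajectory` realises
every control; `u ↦ u (t - ·)` preserves admissibility in both directions. -/
lemma reachSet_singleton {d : ℕ} {μ t : ℝ} (ht : 0 ≤ t) (x₀ : Fin d → ℝ) :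
    reachSet d μ {x₀} t =
      (fun y => freeEvolution t x₀ + y) '' (Matrix.toLin' (momentMatrix d) '' momentSet d μ t) := by
  have hrev : ∀ i : Fin d, ((i.rev : Fin d) : ℕ) = d - 1 - i := fun i => by
    rw [Fin.val_rev]
    omega
  have key : ∀ (u : ℝ → ℝ) (x : ℝ → Fin d → ℝ), IsTrajectory d t u x → x 0 = x₀ →
      x t = freeEvolution t x₀ + Matrix.toLin' (momentMatrix d)
        fun k => ∫ s in (0 : ℝ)..t, s ^ (k : ℕ) * u (t - s) := by
    rintro u x hx rfl
    ext i
    rw [hx.apply_eq ht, integral_sub_pow_mul, Pi.add_apply, Matrix.toLin'_apply,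
      momentMatrix_mulVec, hrev]
  rw [image_image]
  ext y
  constructor
  · rintro ⟨u, x, hu, hx, h0, rfl⟩
    exact ⟨_, ⟨_, hu.comp_sub, fun k => rfl⟩, (key u x hx h0).symm⟩
  · rintro ⟨m, ⟨u, hu, hm⟩, rfl⟩
    obtain ⟨x, hx, h0⟩ := exists_isTrajectory ht hu.comp_sub x₀
    refine ⟨_, x, hu.comp_sub, hx, h0, ?_⟩
    rw [key _ x hx h0]
    simp only [sub_sub_cancel, hm]

lemma convex_reachSet_singleton {d : ℕ} {μ t : ℝ} (ht : 0 ≤ t) (x₀ : Fin d → ℝ) :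
    Convex ℝ (reachSet d μ {x₀} t) := by
  rw [reachSet_singleton ht]
  exact ((convex_momentSet d μ ht).linear_image _).translate _

lemma volume_reachSet_singleton {d : ℕ} {μ t : ℝ} (hμ : 0 < μ) (ht : 0 < t) (x₀ : Fin d → ℝ) :
    volume (reachSet d μ {x₀} t) = ENNReal.ofReal ((2 * μ) ^ d * t ^ (d * (d + 1) / 2) /
      (∏ k ∈ Finset.Icc 1 (d - 1), (k.factorial : ℝ)) *
        ∫ s in openSimplex d 1, vandermondeProd s) := by
  rw [reachSet_singleton ht.le, image_add_left, measure_preimage_add,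
    Measure.addHaar_image_linearMap, LinearMap.det_toLin', abs_det_momentMatrix,
    volume_momentSet hμ ht, setIntegral_vandermondeProd_openSimplex d ht,
    ← ENNReal.ofReal_mul (inv_nonneg.2 (Finset.prod_nonneg fun _ _ => by positivity))]
  congr 1
  ring

end Integrator

theorem theorem1 (d : ℕ) (hd : 2 ≤ d) (μ : ℝ) (hμ : 0 < μ) (x₀ : Fin d → ℝ) (t : ℝ) (ht : 0 < t) :
    NullMeasurableSet (Integrator.reachSet d μ {x₀} t) volume ∧
    ∃ L : ℝ,
      Tendsto (fun n : ℕ => 1 / (n : ℝ) ^ (d * (d + 1) / 2) * Integrator.vandermondeSum d n)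
        atTop (𝓝 L) ∧
      volume (Integrator.reachSet d μ {x₀} t) =
        ENNReal.ofReal
          ((2 * μ) ^ d * t ^ (d * (d + 1) / 2) /
            (∏ k ∈ Finset.Icc 1 (d - 1), (k.factorial : ℝ)) * L) :=
  ⟨(Integrator.convex_reachSet_singleton ht.le x₀).nullMeasurableSet volume, _,
    Integrator.tendsto_vandermondeSum d, Integrator.volume_reachSet_singleton hμ ht x₀⟩
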